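/- All graphs are finite and simple. Let $n,t,c$ be integers with $0\le t\le n-2$ and $c\ge 1$, and let $\alpha\ge 0$ be a real number. A graph is $c$-cyclic if it is connected and its number of edges equals its number of vertices plus $c-1$. For a non-increasing sequence $\pi=(d_1,\dots,d_n)$, let $\Gamma(\pi,t;c)$ be the class of all graphs with degree sequence $\pi$ of the form $K_t\vee H$, where $H$ is a $c$-cyclic graph with $n-t$ vertices ($K_t$ is the complete graph on $t$ vertices, $K_0$ is the null graph, and $\vee$ denotes the join, in which every vertex of $K_t$ is joined to every vertex of $H$). For a graph $G$ with adjacency matrix $A(G)$ and diagonal degree matrix $D(G)$, let $\Theta(G,\alpha)$ be the largest eigenvalue of $M_\alpha(G)=A(G)+\alpha D(G)$; when $G$ is connected, let $f_G$ be its Perron vector, that is, the unit eigenvector of $M_\alpha(G)$ for $\Theta(G,\alpha)$ with all entries positive. For a $c$-cyclic graph $H$ with $c\ge 1$, the basic graph $\mathcal B(H)$ is the graph obtained from $H$ by recursively deleting vertices of degree one until none remain. Theorem 3.8. Let $G_\pi=K_t\vee H$ be a $\Theta_\alpha$-maximal graph of $\Gamma(\pi,t;c)$, that is, $G_\pi\in\Gamma(\pi,t;c)$,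 where $H$ is $c$-cyclic, and $\Theta(G_\pi,\alpha)\ge\Theta(G',\alpha)$ for every $G'\in\Gamma(\pi,t;c)$. Let $u,v\in V(\mathcal B(H))$. If $d_{\mathcal B(H)}(u)>d_{\mathcal B(H)}(v)$, then $f_{G_\pi}(u)>f_{G_\pi}(v)$. Moreover, $f_{G_\pi}(u)=f_{G_\pi}(v)$ implies $d_{\mathcal B(H)}(u)=d_{\mathcal B(H)}(v)$. -/

import Mathlib

namespace SimpleGraph

/-- The join `G ∨ H`: the disjoint union of `G` and `H`, together with all edges between them. -/
def join {V W : Type*} (G : SimpleGraph V) (H : SimpleGraph W) : SimpleGraph (V ⊕ W) :=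
  (G ⊕g H) ⊔ completeBipartiteGraph V W

/-- A `c`-cyclic graph: connected, with `m` edges and `n` vertices, where `m = n + c - 1`. -/
def IsCyclicOfRank {V : Type*} [Fintype V] (G : SimpleGraph V) (c : ℕ) : Prop :=
  G.Connected ∧ G.edgeSet.ncard + 1 = Fintype.card V + c

open Classical in
/-- The degrees of the vertices of `G`, listed in non-increasing order. -/
noncomputable def degreeSequence {V : Type*} [Fintype V] (G : SimpleGraph V) : List ℕ :=
  ((Finset.univ : Finset V).val.map fun v => G.degree v).sort (· ≥ ·)

/-- The class `Γ(π, t; c)` of `t`-cone `c`-cyclic graphs with degree sequence `π`, realized as the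
graphs on the vertex set `Fin n` that are isomorphic to `K_t ∨ H` for some `c`-cyclic graph `H`
with `n - t` vertices. -/
def coneCyclicClass (n : ℕ) (π : List ℕ) (t c : ℕ) : Set (SimpleGraph (Fin n)) :=
  {G | G.degreeSequence = π ∧
    ∃ H : SimpleGraph (Fin (n - t)),
      H.IsCyclicOfRank c ∧ Nonempty (G ≃g (completeGraph (Fin t)).join H)}

open Classical in
/-- The general matrix `M_α(G) = A(G) + α D(G)`. -/
noncomputable def generalMatrix {V : Type*} [Fintype V] [DecidableEq V]
    (G : SimpleGraph V) (α : ℝ) : Matrix V V ℝ :=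
  G.adjMatrix ℝ + α • G.degMatrix ℝ

/-- The general spectral radius `Θ(G, α)`: the largest (real) eigenvalue of `M_α(G)`. -/
noncomputable def generalSpectralRadius {V : Type*} [Fintype V] [DecidableEq V]
    (G : SimpleGraph V) (α : ℝ) : ℝ :=
  sSup (spectrum ℝ (G.generalMatrix α))

theorem isHermitian_generalMatrix {V : Type*} [Fintype V] [DecidableEq V]
    (G : SimpleGraph V) (α : ℝ) : (G.generalMatrix α).IsHermitian := by
  classical
  unfold generalMatrix
  refine Matrix.IsHermitian.add (isHermitian_adjMatrix ℝ G) ?_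
  ext i j
  have h := (isHermitian_degMatrix ℝ G).apply i j
  simpa using Or.inl h

/-- The supremum in the definition of `Θ(G, α)` is attained: it is the largest eigenvalue. -/
theorem isGreatest_generalSpectralRadius {V : Type*} [Fintype V] [DecidableEq V] [Nonempty V]
    (G : SimpleGraph V) (α : ℝ) :
    IsGreatest (spectrum ℝ (G.generalMatrix α)) (G.generalSpectralRadius α) := by
  have hA := G.isHermitian_generalMatrix α
  have hfin : (spectrum ℝ (G.generalMatrix α)).Finite := Matrix.finite_real_spectrum
  have hne : (spectrum ℝ (G.generalMatrix α)).Nonempty :=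
    ⟨_, hA.eigenvalues_mem_spectrum_real (Classical.arbitrary V)⟩
  exact ⟨hne.csSup_mem hfin, fun _ hx => le_csSup hfin.bddAbove hx⟩

/-- `G` is a `Θ_α`-maximal graph of the class `𝒢`. -/
def IsThetaMaximal {V : Type*} [Fintype V] [DecidableEq V]
    (𝒢 : Set (SimpleGraph V)) (α : ℝ) (G : SimpleGraph V) : Prop :=
  G ∈ 𝒢 ∧ ∀ G' ∈ 𝒢, G'.generalSpectralRadius α ≤ G.generalSpectralRadius α

/-- `f` is the Perron vector of `M_α(G)`: the positive unit eigenvector for `Θ(G, α)`. -/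
def IsPerronVector {V : Type*} [Fintype V] [DecidableEq V]
    (G : SimpleGraph V) (α : ℝ) (f : V → ℝ) : Prop :=
  (∀ v, 0 < f v) ∧ ∑ v, f v ^ 2 = 1 ∧
    (G.generalMatrix α).mulVec f = G.generalSpectralRadius α • f

/-- Delete from the subgraph of `H` induced on `S` all its pendant vertices, that is, its vertices
of degree one; the result is the set of the remaining vertices. -/
def deletePendants {W : Type*} (H : SimpleGraph W) (S : Set W) : Set W :=
  {v ∈ S | (H.neighborSet v ∩ S).ncard ≠ 1}

/-- The vertices that remain when the pendant vertices are deleted recursively. The sets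
`(H.deletePendants)^[k] univ` decrease in `k`, so for finite `H` they are eventually constant and
the intersection is their final value. -/
def basicVerts {W : Type*} (H : SimpleGraph W) : Set W :=
  ⋂ k : ℕ, (H.deletePendants)^[k] Set.univ

/-- The basic graph `𝓑(H)` of a `c`-cyclic graph `H` with `1 ≤ c`: the graph obtained from `H` by
recursively deleting pendant vertices until none remain. -/
def basicGraph {W : Type*} (H : SimpleGraph W) : SimpleGraph H.basicVerts :=
  H.induce H.basicVerts

end SimpleGraph

/-! For a set `Z` of base vertices, let each member exchange its adjacencies to `u` and `v`. With
`h` the Perron vector on the base, let `s` be the loss at `u` of neighbours weighted by `h`, and `k`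
the loss counted without weights. The quadratic form of `h` grows by `2 (h v - h u) s + α (h v ^ 2 -
h u ^ 2) k`. If a `u`-`v` walk avoids `Z`, connectedness survives. If `k` is `0` or `d(u) - d(v)`,
so does the degree sequence. Suppose `s > 0`, `k ≥ 0` and `h u ≤ h v`. The form does not drop, so
maximality makes `h` satisfy the same equations in the new graph, yet row `u` has lost `s + α (h u)
k > 0`. Hence `h v < h u` (`IsExtremalVector.lt_of_exchange`).

Moving private neighbours of `u` shows that larger degree gives a larger entry; trading one
neighbour `x` of `u` for one neighbour `y` of `v` gives a comparison whenever `h y < h x`. Induction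
on the deletion round then puts every nonbasic entry below every basic one
(`IsExtremalVector.lt_of_isPendantAt`). Finally, if `u` has the larger basic degree but `h u ≤ h v`,
then `d(u) ≤ d(v)`, so `v` has a nonbasic neighbour `y`, while `u` has a basic neighbour `x` to
trade for it: a contradiction. -/

namespace SimpleGraph

/-! ### Rayleigh quotients and the general spectral radius -/

section Spectral

variable {V : Type*} [Fintype V] [DecidableEq V]

open Classical in
theorem generalMatrix_mulVec_apply (G : SimpleGraph V) (α : ℝ) (f : V → ℝ) (v : V) :
    (G.generalMatrix α).mulVec f v = ∑ w, if G.Adj v w then f w + α * f v else 0 := by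
  have h : ∀ w, (if G.Adj v w then f w + α * f v else 0)
      = (if G.Adj v w then f w else 0) + (if G.Adj v w then (1 : ℝ) else 0) * (α * f v) := by
    intro w; split_ifs <;> ring
  rw [Finset.sum_congr rfl fun w _ => h w, Finset.sum_add_distrib, ← Finset.sum_mul]
  unfold generalMatrix
  rw [Matrix.add_mulVec, Pi.add_apply, Matrix.smul_mulVec, Pi.smul_apply]
  congr 1
  · rw [adjMatrix_mulVec_apply, ← Finset.sum_filter]
    congr 1
    ext w; simp
  · rw [degMatrix, Matrix.mulVec_diagonal, Finset.sum_boole, ← card_neighborFinset_eq_degree,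
      show G.neighborFinset v = Finset.univ.filter (G.Adj v) by ext w; simp, smul_eq_mul]
    ring

theorem posSemidef_generalSpectralRadius_sub (G : SimpleGraph V) [Nonempty V] (α : ℝ) :
    (G.generalSpectralRadius α • (1 : Matrix V V ℝ) - G.generalMatrix α).PosSemidef := by
  have hA := G.isHermitian_generalMatrix α
  have hI : (G.generalSpectralRadius α • (1 : Matrix V V ℝ)).IsHermitian := by
    ext i j
    by_cases h : i = j
    · simp [h]
    · simp [h, Ne.symm h]
  have hH := hI.sub hA
  refine hH.posSemidef_iff_eigenvalues_nonneg.2 fun i => ?_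
  obtain ⟨μ, hμ⟩ : ∃ μ, hH.eigenvalues i = μ := ⟨_, rfl⟩
  have hi := hH.eigenvalues_mem_spectrum_real i
  rw [hμ, ← Algebra.algebraMap_eq_smul_one, ← spectrum.singleton_sub_eq] at hi
  obtain ⟨a, ha, b, hb, hab⟩ := Set.mem_sub.1 hi
  rw [Pi.zero_apply, hμ, ← hab, Set.mem_singleton_iff.1 ha]
  exact sub_nonneg.2 ((G.isGreatest_generalSpectralRadius α).2 hb)

/-- A vector whose Rayleigh quotient is at least the spectral radius is an eigenvector. -/
theorem mulVec_eq_of_generalSpectralRadius_le (G : SimpleGraph V) [Nonempty V] (α : ℝ) (f : V → ℝ)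
    (h : G.generalSpectralRadius α * (f ⬝ᵥ f) ≤ f ⬝ᵥ (G.generalMatrix α).mulVec f) :
    (G.generalMatrix α).mulVec f = G.generalSpectralRadius α • f := by
  have hP := G.posSemidef_generalSpectralRadius_sub α
  have h0 := hP.dotProduct_mulVec_nonneg f
  -- A positive semidefinite form vanishes only on the kernel, so equality in the Rayleigh bound
  -- yields an eigenvector.
  have hz := (hP.dotProduct_mulVec_zero_iff f).1
  simp only [star_trivial, Matrix.sub_mulVec, Matrix.smul_mulVec, Matrix.one_mulVec,
    dotProduct_sub, dotProduct_smul, smul_eq_mul] at h0 hz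
  exact (sub_eq_zero.1 (hz (by linarith))).symm

/-- If the Rayleigh quotient of an eigenvector for the spectral radius of `G` does not decrease on
passing to a graph `G'` with no larger spectral radius, then `M_α(G')` and `M_α(G)` agree on it. -/
theorem mulVec_eq_mulVec_of_le {G G' : SimpleGraph V} [Nonempty V] {α : ℝ} {f : V → ℝ}
    (hf : (G.generalMatrix α).mulVec f = G.generalSpectralRadius α • f) (hf1 : f ⬝ᵥ f = 1)
    (hle : G'.generalSpectralRadius α ≤ G.generalSpectralRadius α)
    (h : f ⬝ᵥ (G.generalMatrix α).mulVec f ≤ f ⬝ᵥ (G'.generalMatrix α).mulVec f) :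
    (G'.generalMatrix α).mulVec f = (G.generalMatrix α).mulVec f := by
  have h1 : f ⬝ᵥ (G.generalMatrix α).mulVec f = G.generalSpectralRadius α := by
    rw [hf, dotProduct_smul, hf1, smul_eq_mul, mul_one]
  have h2 := G'.mulVec_eq_of_generalSpectralRadius_le α f (by rw [hf1]; linarith)
  have h3 : f ⬝ᵥ (G'.generalMatrix α).mulVec f = G'.generalSpectralRadius α := by
    rw [h2, dotProduct_smul, hf1, smul_eq_mul, mul_one]
  rw [h2, hf, le_antisymm hle (by linarith)]

end Spectral

/-! ### Degrees in joins, and invariants of the degree sequence -/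

section Join

variable {V W : Type*}

@[simp] theorem join_adj_inl_inl (G : SimpleGraph V) (H : SimpleGraph W) (a b : V) :
    (G.join H).Adj (Sum.inl a) (Sum.inl b) ↔ G.Adj a b := by simp [join]

@[simp] theorem join_adj_inr_inr (G : SimpleGraph V) (H : SimpleGraph W) (a b : W) :
    (G.join H).Adj (Sum.inr a) (Sum.inr b) ↔ H.Adj a b := by simp [join]

@[simp] theorem join_adj_inl_inr (G : SimpleGraph V) (H : SimpleGraph W) (a : V) (b : W) :
    (G.join H).Adj (Sum.inl a) (Sum.inr b) := by simp [join]

@[simp] theorem join_adj_inr_inl (G : SimpleGraph V) (H : SimpleGraph W) (a : W) (b : V) :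
    (G.join H).Adj (Sum.inr a) (Sum.inl b) := by simp [join]

open Classical in
theorem degree_eq_sum_ite [Fintype V] (G : SimpleGraph V) (v : V) [Fintype (G.neighborSet v)] :
    G.degree v = ∑ w, if G.Adj v w then 1 else 0 := by
  rw [Finset.sum_boole, ← card_neighborFinset_eq_degree, Nat.cast_id]
  congr 1
  ext w; simp

theorem degree_join_inl [Fintype V] [Fintype W] (G : SimpleGraph V) (H : SimpleGraph W) (a : V)
    [Fintype ((G.join H).neighborSet (Sum.inl a))] [Fintype (G.neighborSet a)] :
    (G.join H).degree (Sum.inl a) = G.degree a + Fintype.card W := by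
  classical
  rw [degree_eq_sum_ite, degree_eq_sum_ite, Fintype.sum_sum_type]
  congr 1
  · exact Finset.sum_congr rfl fun x _ => if_congr (join_adj_inl_inl G H a x) rfl rfl
  · simp

theorem degree_join_inr [Fintype V] [Fintype W] (G : SimpleGraph V) (H : SimpleGraph W) (b : W)
    [Fintype ((G.join H).neighborSet (Sum.inr b))] [Fintype (H.neighborSet b)] :
    (G.join H).degree (Sum.inr b) = Fintype.card V + H.degree b := by
  classical
  rw [degree_eq_sum_ite, degree_eq_sum_ite, Fintype.sum_sum_type]
  congr 1
  · simp
  · exact Finset.sum_congr rfl fun x _ => if_congr (join_adj_inr_inr G H b x) rfl rfl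

open Classical in
theorem degreeSequence_eq_of_equiv [Fintype V] [Fintype W] {G : SimpleGraph V} {H : SimpleGraph W}
    (σ : V ≃ W) (h : ∀ v, H.degree (σ v) = G.degree v) : H.degreeSequence = G.degreeSequence := by
  unfold degreeSequence
  congr 1
  have : (Finset.univ : Finset W) = Finset.univ.map σ.toEmbedding := by simp
  rw [this, Finset.map_val, Multiset.map_map]
  exact Multiset.map_congr rfl fun v _ => h v

open Classical in
theorem ncard_edgeSet_eq_of_equiv [Fintype V] [Fintype W] {G : SimpleGraph V} {H : SimpleGraph W}
    (σ : V ≃ W) (h : ∀ v, H.degree (σ v) = G.degree v) : H.edgeSet.ncard = G.edgeSet.ncard := by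
  have h1 := G.sum_degrees_eq_twice_card_edges
  have h2 := H.sum_degrees_eq_twice_card_edges
  rw [← σ.sum_comp, Finset.sum_congr rfl fun v _ => h v, h1] at h2
  rw [← coe_edgeFinset G, ← coe_edgeFinset H, Set.ncard_coe_finset, Set.ncard_coe_finset]
  omega

end Join

/-! ### From maximality of the cone to a condition on its base -/

open Classical in
/-- In a maximal cone graph, replacing the base `H` by a connected graph with the same degrees up
to a permutation cannot increase the quadratic form of the Perron vector, and leaving it unchanged
forces the two matrices to agree on it. -/
theorem IsThetaMaximal.mulVec_base_eq {n t c : ℕ} (ht : t < n) {α : ℝ} {π : List ℕ}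
    {G : SimpleGraph (Fin n)} (hG : IsThetaMaximal (coneCyclicClass n π t c) α G)
    {H : SimpleGraph (Fin (n - t))} (hH : H.IsCyclicOfRank c)
    (e : G ≃g (completeGraph (Fin t)).join H) {f : Fin n → ℝ} (hf : G.IsPerronVector α f)
    {H' : SimpleGraph (Fin (n - t))} (hH' : H'.Connected) (σ : Equiv.Perm (Fin (n - t)))
    (hσ : ∀ w, H'.degree (σ w) = H.degree w) {h : Fin (n - t) → ℝ}
    (hfh : ∀ w, h w = f (e.symm (Sum.inr w)))
    (hle : h ⬝ᵥ (H.generalMatrix α).mulVec h ≤ h ⬝ᵥ (H'.generalMatrix α).mulVec h) :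
    (H'.generalMatrix α).mulVec h = (H.generalMatrix α).mulVec h := by
  have : Nonempty (Fin n) := ⟨⟨0, by omega⟩⟩
  -- Pulling back along the same `e` keeps the vertex labels, so `f` can be tested on both graphs.
  set G' : SimpleGraph (Fin n) := ((completeGraph (Fin t)).join H').comap e.toEquiv with hG'
  let e' : G' ≃g (completeGraph (Fin t)).join H' := ⟨e.toEquiv, Iff.rfl⟩
  have hmem : G' ∈ coneCyclicClass n π t c := by
    refine ⟨?_, H', ⟨hH', ?_⟩, ⟨e'⟩⟩
    · rw [← hG.1.1]
      refine degreeSequence_eq_of_equiv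
        ((e.toEquiv.trans ((Equiv.refl _).sumCongr σ)).trans e'.symm.toEquiv) fun v => ?_
      have h1 : ∀ x, G'.degree (e'.symm x) = ((completeGraph (Fin t)).join H').degree x :=
        fun x => e'.symm.degree_eq x
      have h2 : G.degree v = ((completeGraph (Fin t)).join H).degree (e v) :=
        (e.degree_eq v).symm
      rw [h2]
      refine (h1 _).trans ?_
      change ((completeGraph (Fin t)).join H').degree (Sum.map id σ (e v)) = _
      rcases e v with a | b
      · rw [Sum.map_inl, degree_join_inl, degree_join_inl]; rfl
      · rw [Sum.map_inr, degree_join_inr, degree_join_inr, hσ]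
    · rw [ncard_edgeSet_eq_of_equiv σ hσ]; exact hH.2
  -- Each row splits into a cone part, independent of the base, and a base part; only the latter
  -- survives in the difference of the two forms.
  have hsum : ∀ (K : SimpleGraph (Fin (n - t))) (G₁ : SimpleGraph (Fin n))
      (e₁ : G₁ ≃g (completeGraph (Fin t)).join K), (∀ x, e₁.symm x = e.symm x) → ∀ x,
      (G₁.generalMatrix α).mulVec f (e.symm x) =
      (∑ a, if ((completeGraph (Fin t)).join K).Adj x (Sum.inl a)
        then f (e.symm (Sum.inl a)) + α * f (e.symm x) else 0) +
      ∑ b, if ((completeGraph (Fin t)).join K).Adj x (Sum.inr b)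
        then f (e.symm (Sum.inr b)) + α * f (e.symm x) else 0 := by
    intro K G₁ e₁ he x
    rw [generalMatrix_mulVec_apply, ← e.symm.toEquiv.sum_comp, Fintype.sum_sum_type]
    have hadj : ∀ y, G₁.Adj (e.symm x) (e.symm y) ↔ ((completeGraph (Fin t)).join K).Adj x y := by
      intro y; rw [← he, ← he]; exact e₁.symm.map_adj_iff
    congr 1 <;>
    · refine Finset.sum_congr rfl fun a _ => ?_
      change (if G₁.Adj (e.symm x) (e.symm _) then _ else _) = _
      simp only [hadj]
      rfl
  have hs := hsum H G e fun _ => rfl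
  have hs' := hsum H' G' e' fun _ => rfl
  have hl : ∀ a, (G'.generalMatrix α).mulVec f (e.symm (Sum.inl a))
      = (G.generalMatrix α).mulVec f (e.symm (Sum.inl a)) := by
    intro a; rw [hs, hs']; simp
  have hr : ∀ b, (G'.generalMatrix α).mulVec f (e.symm (Sum.inr b))
      - (G.generalMatrix α).mulVec f (e.symm (Sum.inr b))
      = (H'.generalMatrix α).mulVec h b - (H.generalMatrix α).mulVec h b := by
    intro b; rw [hs, hs', generalMatrix_mulVec_apply, generalMatrix_mulVec_apply]
    simp [hfh]
  have hdiff : f ⬝ᵥ (G'.generalMatrix α).mulVec f - f ⬝ᵥ (G.generalMatrix α).mulVec f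
      = h ⬝ᵥ (H'.generalMatrix α).mulVec h - h ⬝ᵥ (H.generalMatrix α).mulVec h := by
    rw [← dotProduct_sub, ← dotProduct_sub]
    unfold dotProduct
    rw [← e.symm.toEquiv.sum_comp, Fintype.sum_sum_type, Finset.sum_eq_zero, zero_add]
    · refine Finset.sum_congr rfl fun b _ => ?_
      rw [Pi.sub_apply, Pi.sub_apply, ← hr, hfh]; rfl
    · intro a _
      rw [Pi.sub_apply]
      exact mul_eq_zero_of_right _ (sub_eq_zero.2 (hl a))
  have key := mulVec_eq_mulVec_of_le hf.2.2
    (by rw [← hf.2.1]; exact Finset.sum_congr rfl fun v _ => (sq (f v)).symm)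
    (hG.2 G' hmem) (by linarith)
  funext b
  have := hr b
  rw [key, sub_self] at this
  linarith

/-! ### The exchange operation and its effect on degrees and the quadratic form -/

section Exchange

variable {W : Type*} [DecidableEq W]

/-- The graph obtained from `H` by letting every vertex of `Z` exchange its adjacency to `u` with
its adjacency to `v`. -/
def exchangeNbrs (H : SimpleGraph W) (u v : W) (Z : Finset W) : SimpleGraph W where
  Adj a b := H.Adj (if b ∈ Z then Equiv.swap u v a else a) (if a ∈ Z then Equiv.swap u v b else b)
  symm := ⟨fun _ _ h => h.symm⟩
  loopless := ⟨fun a h => by split_ifs at h <;> exact h.ne rfl⟩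

variable {H : SimpleGraph W} {u v : W} {Z : Finset W}

theorem exchangeNbrs_adj_of_notMem {a b : W} (ha : a ∉ Z) (hb : b ∉ Z) :
    (H.exchangeNbrs u v Z).Adj a b ↔ H.Adj a b := by simp [exchangeNbrs, ha, hb]

theorem exchangeNbrs_adj_of_ne {a b : W} (hu : a ≠ u) (hv : a ≠ v) (ha : a ∉ Z) :
    (H.exchangeNbrs u v Z).Adj a b ↔ H.Adj a b := by
  simp [exchangeNbrs, ha, Equiv.swap_apply_of_ne_of_ne hu hv]

theorem exchangeNbrs_adj_of_mem (hu : u ∉ Z) (hv : v ∉ Z) {a b : W} (ha : a ∈ Z) :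
    (H.exchangeNbrs u v Z).Adj a b ↔ H.Adj a (Equiv.swap u v b) := by
  have : Equiv.swap u v a = a :=
    Equiv.swap_apply_of_ne_of_ne (fun h => hu (h ▸ ha)) (fun h => hv (h ▸ ha))
  simp [exchangeNbrs, ha, this]

theorem exchangeNbrs_comm (u v : W) (Z : Finset W) :
    H.exchangeNbrs u v Z = H.exchangeNbrs v u Z := by
  ext a b; simp only [exchangeNbrs, Equiv.swap_comm]

/-- The walk `P` survives because it avoids `Z`. An edge from `Z` to one of `u`, `v` is redirected
to the other, and `P` leads back. -/
theorem exchangeNbrs_connected (hu : u ∉ Z) (hv : v ∉ Z) (hH : H.Connected) (P : H.Walk u v)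
    (hP : ∀ w ∈ P.support, w ∉ Z) : (H.exchangeNbrs u v Z).Connected := by
  have huv : (H.exchangeNbrs u v Z).Reachable u v :=
    ⟨P.transfer _ fun x hx => by
      induction x with
      | _ a b =>
        exact (exchangeNbrs_adj_of_notMem (hP a (P.fst_mem_support_of_mem_edges hx))
          (hP b (P.snd_mem_support_of_mem_edges hx))).2 (P.adj_of_mem_edges hx)⟩
  have key : ∀ a b, a ∈ Z → H.Adj a b → (H.exchangeNbrs u v Z).Reachable a b := by
    intro a b ha hab
    by_cases hbu : b = u
    · subst hbu
      exact (Adj.reachable ((exchangeNbrs_adj_of_mem hu hv ha).2 (by simpa using hab))).trans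
        huv.symm
    by_cases hbv : b = v
    · subst hbv
      exact (Adj.reachable ((exchangeNbrs_adj_of_mem hu hv ha).2 (by simpa using hab))).trans huv
    · exact Adj.reachable ((exchangeNbrs_adj_of_mem hu hv ha).2
        (by rwa [Equiv.swap_apply_of_ne_of_ne hbu hbv]))
  have adj : ∀ a b, H.Adj a b → (H.exchangeNbrs u v Z).Reachable a b := by
    intro a b hab
    by_cases ha : a ∈ Z
    · exact key a b ha hab
    by_cases hb : b ∈ Z
    · exact (key b a hb hab.symm).symm
    · exact Adj.reachable ((exchangeNbrs_adj_of_notMem ha hb).2 hab)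
  have := hH.nonempty
  refine ⟨fun a b => ?_⟩
  obtain ⟨Q⟩ := hH.preconnected a b
  induction Q with
  | nil => exact Reachable.rfl
  | cons h _ ih => exact (adj _ _ h).trans ih

variable [Fintype W]

-- The weight `g` is arbitrary so that constant `1` yields degrees and `h b + α * h u` yields the
-- row of the general matrix.
open Classical in
theorem sum_exchangeNbrs_fst {R : Type*} [AddCommGroup R] (hu : u ∉ Z) (hv : v ∉ Z) (g : W → R) :
    (∑ b, if (H.exchangeNbrs u v Z).Adj u b then g b else 0) = (∑ b, if H.Adj u b then g b else 0)
      - ∑ b ∈ Z, ((if H.Adj u b then g b else 0) - if H.Adj v b then g b else 0) := by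
  have h : ∀ b, (if (H.exchangeNbrs u v Z).Adj u b then g b else 0)
      = (if H.Adj u b then g b else 0)
      - if b ∈ Z then ((if H.Adj u b then g b else 0) - if H.Adj v b then g b else 0) else 0 := by
    intro b
    by_cases hb : b ∈ Z
    · rw [if_pos hb, sub_sub_cancel]
      refine if_congr ?_ rfl rfl
      rw [adj_comm, exchangeNbrs_adj_of_mem hu hv hb, Equiv.swap_apply_left, adj_comm]
    · rw [if_neg hb, sub_zero]
      exact if_congr (exchangeNbrs_adj_of_notMem hu hb) rfl rfl
  rw [Finset.sum_congr rfl fun b _ => h b, Finset.sum_sub_distrib]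
  simp

open Classical in
theorem sum_exchangeNbrs_snd {R : Type*} [AddCommGroup R] (hu : u ∉ Z) (hv : v ∉ Z) (g : W → R) :
    (∑ b, if (H.exchangeNbrs u v Z).Adj v b then g b else 0) = (∑ b, if H.Adj v b then g b else 0)
      + ∑ b ∈ Z, ((if H.Adj u b then g b else 0) - if H.Adj v b then g b else 0) := by
  rw [exchangeNbrs_comm, sum_exchangeNbrs_fst hv hu, sub_eq_add_neg, ← Finset.sum_neg_distrib]
  simp only [neg_sub]

open Classical in
theorem sum_exchangeNbrs_of_ne {R : Type*} [AddCommGroup R] {a : W} (hau : a ≠ u) (hav : a ≠ v)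
    (ha : a ∉ Z) (g : W → R) :
    (∑ b, if (H.exchangeNbrs u v Z).Adj a b then g b else 0) =
      ∑ b, if H.Adj a b then g b else 0 :=
  Finset.sum_congr rfl fun _ _ => if_congr (exchangeNbrs_adj_of_ne hau hav ha) rfl rfl

open Classical in
theorem sum_exchangeNbrs_of_mem {R : Type*} [AddCommGroup R] (hu : u ∉ Z) (hv : v ∉ Z)
    (huv : u ≠ v) {a : W} (ha : a ∈ Z) (g : W → R) :
    (∑ b, if (H.exchangeNbrs u v Z).Adj a b then g b else 0) =
      (∑ b, if H.Adj a b then g b else 0) +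
      ((if H.Adj u a then g v - g u else 0) - if H.Adj v a then g v - g u else 0) := by
  have h1 : (∑ b, if (H.exchangeNbrs u v Z).Adj a b then g b else 0)
      = ∑ b, if H.Adj a b then g (Equiv.swap u v b) else 0 := by
    rw [← Equiv.sum_comp (Equiv.swap u v)]
    refine Finset.sum_congr rfl fun b _ => if_congr ?_ rfl rfl
    rw [exchangeNbrs_adj_of_mem hu hv ha, Equiv.swap_apply_self]
  have h2 : ∀ b, (if H.Adj a b then g (Equiv.swap u v b) else 0) = (if H.Adj a b then g b else 0) +
      ((if b = u then (if H.Adj u a then g v - g u else 0) else 0)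
        - if b = v then (if H.Adj v a then g v - g u else 0) else 0) := by
    intro b
    by_cases hbu : b = u
    · subst hbu
      simp only [if_neg huv, if_true, sub_zero, Equiv.swap_apply_left, H.adj_comm a]
      split_ifs <;> simp
    by_cases hbv : b = v
    · subst hbv
      simp only [if_neg huv.symm, if_true, zero_sub, Equiv.swap_apply_right, H.adj_comm a]
      split_ifs <;> simp
    · rw [Equiv.swap_apply_of_ne_of_ne hbu hbv, if_neg hbu, if_neg hbv]; simp
  rw [h1, Finset.sum_congr rfl fun b _ => h2 b, Finset.sum_add_distrib, Finset.sum_sub_distrib]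
  simp

-- With `k` the sum over `Z`, the degrees of `u` and `v` become `d(u) - k` and `d(v) + k`: unchanged
-- for `k = 0`, interchanged for `k = d(u) - d(v)`. All other degrees are kept.
open Classical in
theorem exchangeNbrs_degree (hu : u ∉ Z) (hv : v ∉ Z) (huv : u ≠ v)
    (hk : (∑ b ∈ Z, ((if H.Adj u b then (1 : ℤ) else 0) - if H.Adj v b then 1 else 0)) = 0 ∨
      (∑ b ∈ Z, ((if H.Adj u b then (1 : ℤ) else 0) - if H.Adj v b then 1 else 0))
        = H.degree u - H.degree v) :
    ∃ σ : Equiv.Perm W, ∀ w, (H.exchangeNbrs u v Z).degree (σ w) = H.degree w := by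
  have hd : ∀ (K : SimpleGraph W) (w : W), (K.degree w : ℤ) = ∑ b, if K.Adj w b then 1 else 0 := by
    intro K w; rw [degree_eq_sum_ite]; push_cast; rfl
  have hdu := sum_exchangeNbrs_fst (H := H) hu hv fun _ => (1 : ℤ)
  have hdv := sum_exchangeNbrs_snd (H := H) hu hv fun _ => (1 : ℤ)
  rw [← hd, ← hd] at hdu hdv
  have hne : ∀ w, w ≠ u → w ≠ v → (H.exchangeNbrs u v Z).degree w = H.degree w := by
    intro w h1 h2
    have h3 : ((H.exchangeNbrs u v Z).degree w : ℤ) = H.degree w := by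
      rw [hd, hd]
      by_cases hw : w ∈ Z
      · rw [sum_exchangeNbrs_of_mem hu hv huv hw fun _ => (1 : ℤ)]; simp
      · exact sum_exchangeNbrs_of_ne h1 h2 hw fun _ => (1 : ℤ)
    exact_mod_cast h3
  rcases hk with hk | hk
  · refine ⟨1, fun w => ?_⟩
    rw [Equiv.Perm.one_apply]
    by_cases h1 : w = u
    · subst h1; omega
    by_cases h2 : w = v
    · subst h2; omega
    · exact hne w h1 h2
  · refine ⟨Equiv.swap u v, fun w => ?_⟩
    by_cases h1 : w = u
    · subst h1; rw [Equiv.swap_apply_left]; omega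
    by_cases h2 : w = v
    · subst h2; rw [Equiv.swap_apply_right]; omega
    · rw [Equiv.swap_apply_of_ne_of_ne h1 h2]; exact hne w h1 h2

open Classical in
theorem exchangeNbrs_mulVec_fst (hu : u ∉ Z) (hv : v ∉ Z) (α : ℝ) (h : W → ℝ) :
    ((H.exchangeNbrs u v Z).generalMatrix α).mulVec h u = (H.generalMatrix α).mulVec h u
      - ∑ b ∈ Z, ((if H.Adj u b then h b else 0) - if H.Adj v b then h b else 0)
      - α * h u * ∑ b ∈ Z, ((if H.Adj u b then 1 else 0) - if H.Adj v b then 1 else 0) := by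
  rw [generalMatrix_mulVec_apply, generalMatrix_mulVec_apply, sum_exchangeNbrs_fst hu hv,
    sub_sub, Finset.mul_sum, ← Finset.sum_add_distrib]
  congr 1
  refine Finset.sum_congr rfl fun b _ => ?_
  split_ifs <;> ring

open Classical in
theorem exchangeNbrs_mulVec_snd (hu : u ∉ Z) (hv : v ∉ Z) (α : ℝ) (h : W → ℝ) :
    ((H.exchangeNbrs u v Z).generalMatrix α).mulVec h v = (H.generalMatrix α).mulVec h v
      + ∑ b ∈ Z, ((if H.Adj u b then h b else 0) - if H.Adj v b then h b else 0)
      + α * h v * ∑ b ∈ Z, ((if H.Adj u b then 1 else 0) - if H.Adj v b then 1 else 0) := by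
  rw [generalMatrix_mulVec_apply, generalMatrix_mulVec_apply, sum_exchangeNbrs_snd hu hv,
    add_assoc, Finset.mul_sum, ← Finset.sum_add_distrib]
  congr 1
  refine Finset.sum_congr rfl fun b _ => ?_
  split_ifs <;> ring

-- Rows `u` and `v` together contribute `(h v - h u) s` and the `α` term; the rows of `Z` contribute
-- `(h v - h u) s` once more, hence the factor `2`.
open Classical in
theorem exchangeNbrs_dotProduct (hu : u ∉ Z) (hv : v ∉ Z) (huv : u ≠ v) (α : ℝ) (h : W → ℝ) :
    h ⬝ᵥ ((H.exchangeNbrs u v Z).generalMatrix α).mulVec h - h ⬝ᵥ (H.generalMatrix α).mulVec h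
      = 2 * (h v - h u) *
        (∑ b ∈ Z, ((if H.Adj u b then h b else 0) - if H.Adj v b then h b else 0))
      + α * (h v ^ 2 - h u ^ 2) *
        ∑ b ∈ Z, ((if H.Adj u b then 1 else 0) - if H.Adj v b then 1 else 0) := by
  set s := ∑ b ∈ Z, ((if H.Adj u b then h b else 0) - if H.Adj v b then h b else 0) with hs
  set k := ∑ b ∈ Z, ((if H.Adj u b then (1 : ℝ) else 0) - if H.Adj v b then 1 else 0) with hk
  set D : W → ℝ := ((H.exchangeNbrs u v Z).generalMatrix α).mulVec h
    - (H.generalMatrix α).mulVec h with hD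
  have hterm : ∀ a, h a * D a = (if a = u then h u * (-s - α * h u * k) else 0) +
      (if a = v then h v * (s + α * h v * k) else 0) +
      if a ∈ Z then (h v - h u) * ((if H.Adj u a then h a else 0) - if H.Adj v a then h a else 0)
        else 0 := by
    intro a
    rw [hD, Pi.sub_apply]
    by_cases h1 : a = u
    · subst h1
      rw [exchangeNbrs_mulVec_fst hu hv, if_pos rfl, if_neg huv, if_neg hu]
      ring
    by_cases h2 : a = v
    · subst h2
      rw [exchangeNbrs_mulVec_snd hu hv, if_pos rfl, if_neg huv.symm, if_neg hv]
      ring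
    rw [if_neg h1, if_neg h2, generalMatrix_mulVec_apply, generalMatrix_mulVec_apply]
    by_cases h3 : a ∈ Z
    · rw [sum_exchangeNbrs_of_mem hu hv huv h3 (fun b => h b + α * h a), if_pos h3]
      split_ifs <;> ring
    · rw [sum_exchangeNbrs_of_ne h1 h2 h3 (fun b => h b + α * h a), if_neg h3]
      ring
  rw [← dotProduct_sub, ← hD, dotProduct, Finset.sum_congr rfl fun a _ => hterm a,
    Finset.sum_add_distrib, Finset.sum_add_distrib]
  simp only [Finset.sum_ite_eq', Finset.mem_univ, if_true, Finset.sum_ite_mem, Finset.univ_inter]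
  rw [← Finset.mul_sum, ← hs]
  ring

end Exchange

/-! ### Shortest paths and private neighbours -/

section ShortestWalk

variable {W : Type*} {H : SimpleGraph W}

/-- Distinct vertices of a connected graph are joined by a path whose only neighbour of the first
vertex `u` is the second vertex `p`; a common neighbour of the ends forces `p` to be the last vertex
or one of its neighbours. -/
theorem Connected.exists_isPath_snd (hH : H.Connected) {u v : W} (huv : u ≠ v) :
    ∃ (P : H.Walk u v) (p : W), P.IsPath ∧ p ∈ P.support ∧ H.Adj u p ∧
      (∀ w ∈ P.support, H.Adj u w → w = p) ∧
      ∀ w, H.Adj u w → H.Adj v w → p = v ∨ H.Adj v p := by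
  classical
  -- On a shortest path, a second neighbour of `u` would be a shortcut, and a common neighbour of
  -- the ends bounds the length by two.
  obtain ⟨P, hP, hlen⟩ := hH.exists_path_of_dist u v
  cases P with
  | nil => exact absurd rfl huv
  | @cons _ p _ hp Q =>
    refine ⟨_, p, hP, by simp, hp, fun w hw hadj => ?_, fun w huw hvw => ?_⟩
    · rw [Walk.support_cons, List.mem_cons] at hw
      rcases hw with rfl | hw
      · exact absurd rfl hadj.ne
      have h1 := H.dist_le (Walk.cons hadj (Q.dropUntil w hw))
      have h2 := congrArg Walk.length (Q.take_spec hw)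
      rw [Walk.length_append] at h2
      rw [← hlen, Walk.length_cons, Walk.length_cons] at h1
      exact (Walk.eq_of_length_eq_zero (p := Q.takeUntil w hw) (by omega)).symm
    · have h1 := H.dist_le (Walk.cons huw (Walk.cons hvw.symm Walk.nil))
      rw [← hlen] at h1
      simp only [Walk.length_cons, Walk.length_nil] at h1
      cases Q with
      | nil => exact Or.inl rfl
      | cons h Q' =>
        rw [Walk.length_cons] at h1
        have := Walk.eq_of_length_eq_zero (p := Q') (by omega)
        subst this
        exact Or.inr h.symm

theorem Walk.IsPath.exists_two_neighbors {u v : W} {P : H.Walk u v} (hP : P.IsPath) {w : W}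
    (hw : w ∈ P.support) (hu : w ≠ u) (hv : w ≠ v) :
    ∃ a ∈ P.support, ∃ b ∈ P.support, a ≠ b ∧ H.Adj w a ∧ H.Adj w b := by
  induction P with
  | nil => simp at hw; exact absurd hw hu
  | @cons u p v h Q ih =>
    rw [Walk.cons_isPath_iff] at hP
    rw [Walk.support_cons, List.mem_cons] at hw
    rcases hw with rfl | hw
    · exact absurd rfl hu
    by_cases hp : w = p
    · subst hp
      cases Q with
      | nil => exact absurd rfl hv
      | @cons _ b _ h' Q' =>
        refine ⟨u, by simp, b, by simp, ?_, h.symm, h'⟩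
        rintro rfl
        exact hP.2 (by simp)
    · obtain ⟨a, ha, b, hb, hab⟩ := ih hP.1 hw hp hv
      exact ⟨a, by simp [ha], b, by simp [hb], hab⟩

variable [Fintype W]

-- The neighbours of `u` in `S` that are not private fit in a set `X` no larger than the
-- neighbourhood of `v` in `S`. If `u` and `v` are adjacent, `X` is that neighbourhood with `u`
-- replaced by `v = p`. If they only share a neighbour, `p` is adjacent to `v` and the neighbourhood
-- itself serves. Otherwise `{p}` does, by `hv`.
open Classical in
theorem card_neighbors_le {u v p : W} (S : Set W) (hu : u ∈ S)
    (hv : ∃ w, H.Adj v w ∧ w ∈ S) (hadj : H.Adj u v → v = p)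
    (hp : ∀ w, H.Adj u w → H.Adj v w → p = v ∨ H.Adj v p) :
    (Finset.univ.filter fun w => H.Adj u w ∧ w ∈ S).card ≤
      (Finset.univ.filter fun w => (H.Adj u w ∧ w ∈ S) ∧ ¬ H.Adj v w ∧ w ≠ v ∧ w ≠ p).card +
      (Finset.univ.filter fun w => H.Adj v w ∧ w ∈ S).card := by
  have main : ∀ X : Finset W,
      (∀ w, H.Adj u w → w ∈ S → H.Adj v w ∨ w = v ∨ w = p → w ∈ X) →
      X.card ≤ (Finset.univ.filter fun w => H.Adj v w ∧ w ∈ S).card →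
      (Finset.univ.filter fun w => H.Adj u w ∧ w ∈ S).card ≤
      (Finset.univ.filter fun w => (H.Adj u w ∧ w ∈ S) ∧ ¬ H.Adj v w ∧ w ≠ v ∧ w ≠ p).card +
      (Finset.univ.filter fun w => H.Adj v w ∧ w ∈ S).card := by
    intro X hX hcard
    refine le_trans (Finset.card_le_card (t := _ ∪ X) fun w hw => ?_)
      ((Finset.card_union_le _ _).trans (Nat.add_le_add_left hcard _))
    simp only [Finset.mem_filter, Finset.mem_univ, true_and, Finset.mem_union] at hw ⊢
    have := hX w hw.1 hw.2
    tauto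
  by_cases huv : H.Adj u v
  · refine main (insert v ((Finset.univ.filter fun w => H.Adj v w ∧ w ∈ S).erase u)) ?_ ?_
    · intro w h1 h2 h3
      simp only [Finset.mem_insert, Finset.mem_erase, Finset.mem_filter, Finset.mem_univ, true_and]
      have := hadj huv
      rcases h3 with h3 | h3 | h3
      · exact Or.inr ⟨h1.ne', h3, h2⟩
      · exact Or.inl h3
      · exact Or.inl (h3.trans this.symm)
    · refine (Finset.card_insert_le _ _).trans ?_
      rw [Finset.card_erase_add_one]
      simp [hu, huv.symm]
  by_cases hc : ∃ w, H.Adj u w ∧ H.Adj v w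
  · refine main _ (fun w h1 h2 h3 => ?_) le_rfl
    simp only [Finset.mem_filter, Finset.mem_univ, true_and]
    obtain ⟨x, hx, hx'⟩ := hc
    refine ⟨?_, h2⟩
    rcases h3 with h3 | h3 | h3
    · exact h3
    · exact absurd (h3 ▸ h1) huv
    · rcases hp x hx hx' with h4 | h4
      · exact absurd (h4 ▸ h3 ▸ h1) huv
      · exact h3 ▸ h4
  · refine main {p} (fun w h1 h2 h3 => ?_) ?_
    · rcases h3 with h3 | h3 | h3
      · exact absurd ⟨w, h1, h3⟩ hc
      · exact absurd (h3 ▸ h1) huv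
      · simp [h3]
    · rw [Finset.card_singleton, Nat.succ_le_iff, Finset.card_pos]
      obtain ⟨w, hw⟩ := hv
      exact ⟨w, by simpa using hw⟩

end ShortestWalk

/-! ### Comparing entries of an extremal vector -/

section Extremal

variable {W : Type*} [Fintype W] [DecidableEq W]

open Classical in
/-- `h` is a positive vector on the connected graph `H`, and a connected graph with the same degrees
up to a permutation can have an equal or larger quadratic form at `h` only if its general matrix
agrees with that of `H` on `h`. -/
structure IsExtremalVector (H : SimpleGraph W) (α : ℝ) (h : W → ℝ) : Prop where
  connected : H.Connected
  pos : ∀ w, 0 < h w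
  mulVec_eq : ∀ (H' : SimpleGraph W) (σ : Equiv.Perm W), H'.Connected →
    (∀ w, H'.degree (σ w) = H.degree w) →
    h ⬝ᵥ (H.generalMatrix α).mulVec h ≤ h ⬝ᵥ (H'.generalMatrix α).mulVec h →
    (H'.generalMatrix α).mulVec h = (H.generalMatrix α).mulVec h

variable {H : SimpleGraph W} {α : ℝ} {h : W → ℝ} {u v : W}

open Classical in
theorem IsExtremalVector.lt_of_exchange (hE : H.IsExtremalVector α h) (hα : 0 ≤ α) {Z : Finset W}
    (huv : u ≠ v) (hu : u ∉ Z) (hv : v ∉ Z) (P : H.Walk u v) (hP : ∀ w ∈ P.support, w ∉ Z) (k : ℕ)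
    (hs : 0 < ∑ b ∈ Z, ((if H.Adj u b then h b else 0) - if H.Adj v b then h b else 0))
    (hk : ∑ b ∈ Z, ((if H.Adj u b then (1 : ℤ) else 0) - if H.Adj v b then 1 else 0) = k)
    (hk' : k = 0 ∨ H.degree u = H.degree v + k) : h v < h u := by
  by_contra! hle
  have hkR : ∑ b ∈ Z, ((if H.Adj u b then (1 : ℝ) else 0) - if H.Adj v b then 1 else 0) = k := by
    have := congrArg (Int.cast : ℤ → ℝ) hk
    push_cast at this
    exact this
  obtain ⟨σ, hσ⟩ := exchangeNbrs_degree (H := H) hu hv huv (by rw [hk]; omega)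
  have hquad := exchangeNbrs_dotProduct (H := H) hu hv huv α h
  rw [hkR] at hquad
  have h1 : 0 ≤ α * (h v ^ 2 - h u ^ 2) * k :=
    mul_nonneg (mul_nonneg hα (by nlinarith [hE.pos u, hE.pos v])) k.cast_nonneg
  have h2 := mul_nonneg (mul_nonneg zero_le_two (sub_nonneg.2 hle)) hs.le
  have heq := congrFun (hE.mulVec_eq _ σ (exchangeNbrs_connected hu hv hE.connected P hP) hσ
    (by linarith)) u
  rw [exchangeNbrs_mulVec_fst hu hv, hkR] at heq
  have h3 : 0 ≤ α * h u * k := mul_nonneg (mul_nonneg hα (hE.pos u).le) k.cast_nonneg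
  linarith

-- `Z` consists of `d(u) - d(v)` neighbours of `u` that are not adjacent to `v` and lie off a
-- shortest path; moving them interchanges the two degrees.
open Classical in
theorem IsExtremalVector.lt_of_degree_lt (hE : H.IsExtremalVector α h) (hα : 0 ≤ α)
    (hd : H.degree v < H.degree u) : h v < h u := by
  have huv : u ≠ v := by rintro rfl; exact hd.false
  obtain ⟨P, p, -, -, -, hPu, hc⟩ := hE.connected.exists_isPath_snd huv
  have : Nontrivial W := ⟨u, v, huv⟩
  obtain ⟨w, hw⟩ := hE.connected.preconnected.exists_adj_of_nontrivial v
  have hcard := card_neighbors_le (H := H) (u := u) (v := v) (p := p) Set.univ trivial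
    ⟨w, hw, trivial⟩ (hPu v P.end_mem_support) hc
  simp only [Set.mem_univ, and_true] at hcard
  rw [← neighborFinset_eq_filter, ← neighborFinset_eq_filter, card_neighborFinset_eq_degree,
    card_neighborFinset_eq_degree] at hcard
  obtain ⟨Z, hZ, hZc⟩ := Finset.exists_subset_card_eq
    (show H.degree u - H.degree v ≤ _ by exact Nat.sub_le_iff_le_add.2 hcard)
  have hmem : ∀ b ∈ Z, H.Adj u b ∧ ¬ H.Adj v b ∧ b ≠ v ∧ b ≠ p := fun b hb => by
    simpa using hZ hb
  have hterm : ∀ {R : Type} [AddGroup R] (g : W → R), ∀ b ∈ Z,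
      ((if H.Adj u b then g b else 0) - if H.Adj v b then g b else 0) = g b := by
    intro R _ g b hb
    rw [if_pos (hmem b hb).1, if_neg (hmem b hb).2.1, sub_zero]
  refine hE.lt_of_exchange hα huv (fun hu => (hmem u hu).1.ne rfl) (fun hv => (hmem v hv).2.2.1 rfl)
    P (fun w hw hwZ => (hmem w hwZ).2.2.2 (hPu w hw (hmem w hwZ).1)) Z.card ?_ ?_
    (Or.inr (by omega))
  · rw [Finset.sum_congr rfl (hterm h)]
    exact Finset.sum_pos (fun b _ => hE.pos b) (Finset.card_pos.1 (by omega))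
  · rw [Finset.sum_congr rfl (hterm fun _ => (1 : ℤ))]; simp

/-- The exchange on `{x, y}` keeps every degree (`k = 0`), and `s = h x - h y`. -/
theorem IsExtremalVector.lt_of_switch (hE : H.IsExtremalVector α h) (hα : 0 ≤ α) {x y : W}
    (huv : u ≠ v) (P : H.Walk u v) (hux : H.Adj u x) (hvx : ¬ H.Adj v x) (hx : x ∉ P.support)
    (hvy : H.Adj v y) (huy : ¬ H.Adj u y) (hy : y ∉ P.support) (hxy : h y < h x) : h v < h u := by
  classical
  have hne : x ≠ y := by rintro rfl; exact hvx hvy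
  have hnot : ∀ w ∈ P.support, w ∉ ({x, y} : Finset W) := by
    intro w hw hmem
    rcases Finset.mem_insert.1 hmem with rfl | hmem
    · exact hx hw
    · rw [Finset.mem_singleton] at hmem
      exact hy (hmem ▸ hw)
  refine hE.lt_of_exchange hα (Z := {x, y}) huv (hnot u P.start_mem_support)
    (hnot v P.end_mem_support) P hnot 0 ?_ ?_ (Or.inl rfl) <;>
  rw [Finset.sum_pair hne, if_pos hux, if_neg hvx, if_neg huy, if_pos hvy]
  · linarith
  · simp

end Extremal

/-! ### The structure of recursive pendant deletion -/

section Basic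

variable {W : Type*} {H : SimpleGraph W}

theorem deletePendants_iterate_succ_subset (k : ℕ) :
    H.deletePendants^[k + 1] Set.univ ⊆ H.deletePendants^[k] Set.univ := by
  rw [Function.iterate_succ_apply']
  exact fun _ h => h.1

theorem deletePendants_iterate_antitone : Antitone fun k => H.deletePendants^[k] Set.univ :=
  antitone_nat_of_succ_le deletePendants_iterate_succ_subset

theorem basicVerts_subset (k : ℕ) : H.basicVerts ⊆ H.deletePendants^[k] Set.univ :=
  Set.iInter_subset _ k

/-- The vertex `z` is deleted in round `k`, when `q` is its only remaining neighbour. -/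
def IsPendantAt (H : SimpleGraph W) (k : ℕ) (z q : W) : Prop :=
  z ∈ H.deletePendants^[k] Set.univ ∧
    H.neighborSet z ∩ H.deletePendants^[k] Set.univ = {q}

theorem IsPendantAt.eq_of_adj {k : ℕ} {z q w : W} (hz : H.IsPendantAt k z q) (h : H.Adj z w)
    (hw : w ∈ H.deletePendants^[k] Set.univ) : w = q :=
  Set.mem_singleton_iff.1 (hz.2 ▸ ⟨h, hw⟩)

theorem IsPendantAt.notMem_basicVerts {k : ℕ} {z q : W} (hz : H.IsPendantAt k z q) :
    z ∉ H.basicVerts := by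
  intro h
  have := basicVerts_subset (k + 1) h
  rw [Function.iterate_succ_apply'] at this
  exact this.2 (by rw [hz.2, Set.ncard_singleton])

theorem exists_isPendantAt_lt {k : ℕ} {z : W} (hz : z ∉ H.deletePendants^[k] Set.univ) :
    ∃ j < k, ∃ q, H.IsPendantAt j z q := by
  induction k with
  | zero => exact absurd (Set.mem_univ z) hz
  | succ k ih =>
    by_cases h : z ∈ H.deletePendants^[k] Set.univ
    · rw [Function.iterate_succ_apply'] at hz
      have h1 : (H.neighborSet z ∩ H.deletePendants^[k] Set.univ).ncard = 1 := by
        by_contra h1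
        exact hz ⟨h, h1⟩
      obtain ⟨q, hq⟩ := Set.ncard_eq_one.1 h1
      exact ⟨k, Nat.lt_succ_self k, q, h, hq⟩
    · obtain ⟨j, hj, q, hq⟩ := ih h
      exact ⟨j, hj.trans (Nat.lt_succ_self k), q, hq⟩

theorem exists_isPendantAt {z : W} (hz : z ∉ H.basicVerts) : ∃ k q, H.IsPendantAt k z q := by
  obtain ⟨k, hk⟩ : ∃ k, z ∉ H.deletePendants^[k] Set.univ := by
    simpa [basicVerts] using hz
  obtain ⟨j, -, q, hq⟩ := exists_isPendantAt_lt hk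
  exact ⟨j, q, hq⟩

/-- An inner vertex of a path has two neighbours on it, so it is never pendant while the path is
intact. -/
theorem Walk.IsPath.support_subset_iterate {u v : W} {P : H.Walk u v} (hP : P.IsPath) {k : ℕ}
    (hu : u ∈ H.deletePendants^[k] Set.univ) (hv : v ∈ H.deletePendants^[k] Set.univ) :
    ∀ w ∈ P.support, w ∈ H.deletePendants^[k] Set.univ := by
  induction k with
  | zero => exact fun w _ => Set.mem_univ w
  | succ k ih =>
    intro w hw
    have ih' := ih (deletePendants_iterate_succ_subset k hu)
      (deletePendants_iterate_succ_subset k hv)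
    by_cases h1 : w = u
    · exact h1 ▸ hu
    by_cases h2 : w = v
    · exact h2 ▸ hv
    obtain ⟨a, ha, b, hb, hab, hwa, hwb⟩ := hP.exists_two_neighbors hw h1 h2
    rw [Function.iterate_succ_apply']
    refine ⟨ih' w hw, fun h => ?_⟩
    obtain ⟨q, hq⟩ := Set.ncard_eq_one.1 h
    have hz : H.IsPendantAt k w q := ⟨ih' w hw, hq⟩
    exact hab ((hz.eq_of_adj hwa (ih' a ha)).trans (hz.eq_of_adj hwb (ih' b hb)).symm)

theorem Walk.IsPath.support_subset_basicVerts {u v : W} {P : H.Walk u v} (hP : P.IsPath)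
    (hu : u ∈ H.basicVerts) (hv : v ∈ H.basicVerts) : ∀ w ∈ P.support, w ∈ H.basicVerts :=
  fun w hw => Set.mem_iInter.2 fun k =>
    hP.support_subset_iterate (basicVerts_subset k hu) (basicVerts_subset k hv) w hw

theorem degree_basicGraph (u : H.basicVerts) [Fintype (H.basicGraph.neighborSet u)] :
    H.basicGraph.degree u = (H.neighborSet u ∩ H.basicVerts).ncard := by
  rw [← card_neighborSet_eq_degree, ← Nat.card_eq_fintype_card, Nat.card_coe_set_eq,
    ← Set.ncard_image_of_injective _ Subtype.val_injective]
  congr 1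
  ext w
  simp [basicGraph, and_comm]

variable [Fintype W]

open Classical in
theorem ncard_neighborSet_inter_eq (H : SimpleGraph W) (x : W) (S : Set W) :
    (H.neighborSet x ∩ S).ncard = (Finset.univ.filter fun w => H.Adj x w ∧ w ∈ S).card := by
  rw [← Set.ncard_coe_finset]
  congr 1
  ext w; simp

open Classical in
theorem ncard_neighborSet_inter_le_degree (H : SimpleGraph W) (x : W) (S : Set W) :
    (H.neighborSet x ∩ S).ncard ≤ H.degree x := by
  rw [ncard_neighborSet_inter_eq, ← card_neighborFinset_eq_degree]
  exact Finset.card_le_card fun w hw => by simp at hw; simp [hw.1]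

theorem exists_adj_of_ncard_lt {u v p : W} (S : Set W) (hu : u ∈ S)
    (hv : (H.neighborSet v ∩ S).Nonempty) (hadj : H.Adj u v → v = p)
    (hp : ∀ w, H.Adj u w → H.Adj v w → p = v ∨ H.Adj v p)
    (hlt : (H.neighborSet v ∩ S).ncard < (H.neighborSet u ∩ S).ncard) :
    ∃ x ∈ S, H.Adj u x ∧ ¬ H.Adj v x ∧ x ≠ v ∧ x ≠ p := by
  classical
  by_contra! hno
  have hcard := card_neighbors_le S hu hv hadj hp
  rw [← ncard_neighborSet_inter_eq, ← ncard_neighborSet_inter_eq,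
    Finset.filter_false_of_mem fun w _ hw => hw.2.2.2 (hno w hw.1.2 hw.1.1 hw.2.1 hw.2.2.1),
    Finset.card_empty, zero_add] at hcard
  exact hcard.not_gt hlt

/-- By finiteness, some round comes after the deletion of every nonbasic vertex. -/
theorem exists_basicVerts_eq_iterate (H : SimpleGraph W) :
    ∃ k, H.basicVerts = H.deletePendants^[k] Set.univ := by
  have h : ∀ w, ∃ k, w ∉ H.basicVerts → w ∉ H.deletePendants^[k] Set.univ := by
    intro w
    by_cases hw : w ∈ H.basicVerts
    · exact ⟨0, fun h => absurd hw h⟩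
    · obtain ⟨k, hk⟩ : ∃ k, w ∉ H.deletePendants^[k] Set.univ := by
        simpa [basicVerts] using hw
      exact ⟨k, fun _ => hk⟩
  choose k hk using h
  refine ⟨Finset.univ.sup k, (basicVerts_subset _).antisymm fun w hw => ?_⟩
  by_contra hB
  exact hk w hB (deletePendants_iterate_antitone (Finset.le_sup (Finset.mem_univ w)) hw)

theorem ncard_neighborSet_inter_basicVerts_ne_one {x : W} (hx : x ∈ H.basicVerts) :
    (H.neighborSet x ∩ H.basicVerts).ncard ≠ 1 := by
  obtain ⟨k, hk⟩ := H.exists_basicVerts_eq_iterate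
  have := basicVerts_subset (k + 1) hx
  rw [Function.iterate_succ_apply'] at this
  rw [hk]
  exact this.2

/-- If no edge joins two basic vertices, every edge joins a nonbasic vertex to the neighbour it has
when it is deleted. -/
theorem ncard_edgeSet_le_of_forall_not_adj
    (h : ∀ a ∈ H.basicVerts, ∀ b ∈ H.basicVerts, ¬ H.Adj a b) :
    H.edgeSet.ncard ≤ (H.basicVertsᶜ).ncard := by
  have hex : ∀ z, ∃ kq : ℕ × W, z ∉ H.basicVerts → H.IsPendantAt kq.1 z kq.2 := by
    intro z
    by_cases hz : z ∈ H.basicVerts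
    · exact ⟨(0, z), fun h => absurd hz h⟩
    · obtain ⟨k, q, hq⟩ := exists_isPendantAt hz
      exact ⟨(k, q), fun _ => hq⟩
  choose kq hkq using hex
  have hedge : ∀ a b, a ∉ H.basicVerts → H.Adj a b → b ∈ H.deletePendants^[(kq a).1] Set.univ →
      s(a, b) ∈ (fun z => s(z, (kq z).2)) '' H.basicVertsᶜ :=
    fun a b ha hab hb => ⟨a, ha, by rw [(hkq a ha).eq_of_adj hab hb]⟩
  have hsub : H.edgeSet ⊆ (fun z => s(z, (kq z).2)) '' H.basicVertsᶜ := by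
    intro x hx
    induction x with
    | _ a b =>
      have hab : H.Adj a b := hx
      by_cases ha : a ∈ H.basicVerts
      · have hb : b ∉ H.basicVerts := fun hb => h a ha b hb hab
        rw [Sym2.eq_swap]
        exact hedge b a hb hab.symm (basicVerts_subset _ ha)
      by_cases hb : b ∈ H.basicVerts
      · exact hedge a b ha hab (basicVerts_subset _ hb)
      -- The end deleted no later than the other still sees it, so the edge is charged to that end.
      rcases le_total (kq a).1 (kq b).1 with hle | hle
      · exact hedge a b ha hab (deletePendants_iterate_antitone hle (hkq b hb).1)
      · rw [Sym2.eq_swap]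
        exact hedge b a hb hab.symm (deletePendants_iterate_antitone hle (hkq a ha).1)
  exact (Set.ncard_le_ncard hsub (Set.toFinite _)).trans (Set.ncard_image_le (Set.toFinite _))

/-- Basic degree one is excluded by stability. Basic degree zero makes `x` the only basic vertex,
since paths between basic vertices stay basic; then there are fewer edges than vertices, against `1
≤ c`. -/
theorem IsCyclicOfRank.two_le_ncard_neighborSet_inter {c : ℕ} (hH : H.IsCyclicOfRank c)
    (hc : 1 ≤ c) {x : W} (hx : x ∈ H.basicVerts) :
    2 ≤ (H.neighborSet x ∩ H.basicVerts).ncard := by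
  have h1 := ncard_neighborSet_inter_basicVerts_ne_one hx
  by_contra! hlt
  have h0 : H.neighborSet x ∩ H.basicVerts = ∅ :=
    (Set.ncard_eq_zero (Set.toFinite _)).1 (by omega)
  have hx_only : ∀ w ∈ H.basicVerts, w = x := by
    intro w hw
    by_contra hne
    obtain ⟨P, p, hP, hp, hadj, -⟩ := hH.1.exists_isPath_snd (Ne.symm hne)
    have : p ∈ H.neighborSet x ∩ H.basicVerts := ⟨hadj, hP.support_subset_basicVerts hx hw p hp⟩
    rw [h0] at this
    exact this
  have hle := ncard_edgeSet_le_of_forall_not_adj (H := H)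
    (fun a ha b hb hab => hab.ne ((hx_only a ha).trans (hx_only b hb).symm))
  have hpos : 0 < H.basicVerts.ncard := (Set.ncard_pos (Set.toFinite _)).2 ⟨x, hx⟩
  have hsum := Set.ncard_add_ncard_compl H.basicVerts
  rw [Nat.card_eq_fintype_card] at hsum
  have := hH.2
  omega

end Basic

/-! ### Basic against nonbasic vertices, and the order by basic degree -/

section Main

variable {W : Type*} [Fintype W] [DecidableEq W] {H : SimpleGraph W} {α : ℝ} {h : W → ℝ}

/-- The entries of an extremal vector at basic vertices exceed those at nonbasic vertices. -/
theorem IsExtremalVector.lt_of_isPendantAt (hE : H.IsExtremalVector α h) (hα : 0 ≤ α) {c : ℕ}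
    (hH : H.IsCyclicOfRank c) (hc : 1 ≤ c) (k : ℕ) :
    ∀ z q, H.IsPendantAt k z q → ∀ x ∈ H.basicVerts, h z < h x := by
  classical
  induction k using Nat.strong_induction_on with
  | _ k ih =>
    intro z q hz x hx
    by_contra! hle
    have hxB := hH.two_le_ncard_neighborSet_inter hc hx
    have hdz : 2 ≤ H.degree z := by
      have h1 := ncard_neighborSet_inter_le_degree H x H.basicVerts
      by_contra! h2
      exact hle.not_gt (hE.lt_of_degree_lt hα (by omega))
    have hxz : x ≠ z := fun h => hz.notMem_basicVerts (h ▸ hx)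
    obtain ⟨P, p, hP, hpP, hxp, hPx, hcommon⟩ := hE.connected.exists_isPath_snd hxz
    have hPk := hP.support_subset_iterate (basicVerts_subset k hx) hz.1
    -- Any neighbour of `z` other than `q` was deleted in an earlier round, so the induction
    -- hypothesis places `h z'` below `h x'`. For `k = 0` no such neighbour exists, so no base case
    -- is needed.
    obtain ⟨z', hz', hz'q⟩ := Finset.exists_mem_ne
      (show 1 < (H.neighborFinset z).card by rw [card_neighborFinset_eq_degree]; omega) q
    rw [mem_neighborFinset] at hz'
    have hz'k : z' ∉ H.deletePendants^[k] Set.univ := fun h => hz'q (hz.eq_of_adj hz' h)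
    obtain ⟨j, hj, q', hq'⟩ := exists_isPendantAt_lt hz'k
    obtain ⟨x', ⟨hx', hx'B⟩, hx'p⟩ := Set.exists_ne_of_one_lt_ncard
      (show 1 < (H.neighborSet x ∩ H.basicVerts).ncard by omega) p
    refine hle.not_gt (hE.lt_of_switch hα hxz P hx' (fun hadj => ?_) (fun h => hx'p (hPx x' h hx'))
      hz' (fun hadj => ?_) (fun h => hz'k (hPk z' h)) (ih j hj z' q' hq' x' hx'B))
    -- Were `x'` adjacent to `z`, it would be `q`; the choice of path then makes `x` or `p` equal to
    -- `q` as well.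
    · have hx'q := hz.eq_of_adj hadj (basicVerts_subset k hx'B)
      rcases hcommon x' hx' hadj with hpz | hpz
      · have hxq := hz.eq_of_adj (hpz ▸ hxp.symm) (basicVerts_subset k hx)
        exact hx'.ne (hxq.trans hx'q.symm)
      · exact hx'p (hx'q.trans (hz.eq_of_adj hpz (hPk p hpP)).symm)
    -- In round `j` both `x` and `z` are present, but `z'` has only one neighbour left.
    · exact hxz ((hq'.eq_of_adj hadj.symm (basicVerts_subset j hx)).trans
        (hq'.eq_of_adj hz'.symm (deletePendants_iterate_antitone hj.le hz.1)).symm)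

theorem IsExtremalVector.lt_of_ncard_lt (hE : H.IsExtremalVector α h) (hα : 0 ≤ α) {c : ℕ}
    (hH : H.IsCyclicOfRank c) (hc : 1 ≤ c) {u v : W} (hu : u ∈ H.basicVerts)
    (hv : v ∈ H.basicVerts)
    (hd : (H.neighborSet v ∩ H.basicVerts).ncard < (H.neighborSet u ∩ H.basicVerts).ncard) :
    h v < h u := by
  classical
  by_contra! hle
  have huv : u ≠ v := by rintro rfl; exact hd.false
  have hdeg : H.degree u ≤ H.degree v := by
    by_contra! h1
    exact hle.not_gt (hE.lt_of_degree_lt hα h1)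
  -- If all neighbours of `v` were basic, its degree would be its basic degree, which is less than
  -- `d(u)`.
  obtain ⟨y, hvy, hy⟩ : ∃ y, H.Adj v y ∧ y ∉ H.basicVerts := by
    by_contra! hall
    have h1 := ncard_neighborSet_inter_le_degree H u H.basicVerts
    have h2 : H.neighborSet v ∩ H.basicVerts = H.neighborSet v := Set.inter_eq_left.2 hall
    rw [h2, ← coe_neighborFinset, Set.ncard_coe_finset,
      card_neighborFinset_eq_degree] at hd
    omega
  obtain ⟨k, q, hq⟩ := exists_isPendantAt hy
  obtain ⟨P, p, hP, -, -, hPu, hcommon⟩ := hE.connected.exists_isPath_snd huv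
  have hvB := hH.two_le_ncard_neighborSet_inter hc hv
  obtain ⟨x, hxB, hux, hvx, -, hxp⟩ := exists_adj_of_ncard_lt H.basicVerts hu
    ((Set.ncard_pos (Set.toFinite _)).1 (by omega)) (hPu v P.end_mem_support) hcommon hd
  refine hle.not_gt (hE.lt_of_switch hα huv P hux hvx (fun h => hxp (hPu x h hux)) hvy
    (fun hadj => huv ?_) (fun h => hy (hP.support_subset_basicVerts hu hv y h))
    (hE.lt_of_isPendantAt hα hH hc k y q hq x hxB))
  exact (hq.eq_of_adj hadj.symm (basicVerts_subset k hu)).trans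
    (hq.eq_of_adj hvy.symm (basicVerts_subset k hv)).symm

end Main

end SimpleGraph

open Classical in
theorem theorem3p8 (n t c : ℕ) (ht : t + 2 ≤ n) (hc : 1 ≤ c) (α : ℝ) (hα : 0 ≤ α)
    (π : List ℕ) (G : SimpleGraph (Fin n))
    (hG : SimpleGraph.IsThetaMaximal (SimpleGraph.coneCyclicClass n π t c) α G)
    (H : SimpleGraph (Fin (n - t))) (hH : H.IsCyclicOfRank c)
    (e : G ≃g (SimpleGraph.completeGraph (Fin t)).join H)
    (f : Fin n → ℝ) (hf : G.IsPerronVector α f)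
    (u v : H.basicVerts) :
    (H.basicGraph.degree v < H.basicGraph.degree u →
      f (e.symm (Sum.inr v.1)) < f (e.symm (Sum.inr u.1))) ∧
    (f (e.symm (Sum.inr u.1)) = f (e.symm (Sum.inr v.1)) →
      H.basicGraph.degree u = H.basicGraph.degree v) := by
  have hE : H.IsExtremalVector α fun w => f (e.symm (Sum.inr w)) :=
    ⟨hH.1, fun w => hf.1 _, fun H' σ hH' hσ hle =>
      hG.mulVec_base_eq (by omega) hH e hf hH' σ hσ (fun _ => rfl) hle⟩
  have key : ∀ a b : H.basicVerts, H.basicGraph.degree b < H.basicGraph.degree a →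
      f (e.symm (Sum.inr b.1)) < f (e.symm (Sum.inr a.1)) := by
    intro a b hab
    rw [SimpleGraph.degree_basicGraph, SimpleGraph.degree_basicGraph] at hab
    exact hE.lt_of_ncard_lt hα hH hc a.2 b.2 hab
  refine ⟨key u v, fun huv => ?_⟩
  rcases lt_trichotomy (H.basicGraph.degree u) (H.basicGraph.degree v) with h | h | h
  · exact absurd huv (key v u h).ne
  · exact h
  · exact absurd huv (key u v h).ne'
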